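/- For natural numbers $N$ and $r\ge 1$ let $S_{N,r}$ be the set of tuples $(n_1,\dots,n_r)$ of odd integers $n_i\ge 3$ with $n_1+\cdots+n_r=N$, let $\mathsf{Vect}_{N,r}=\mathbb Q^{S_{N,r}}$ (row vectors), let $\mathbf V_{N,r}\subseteq\mathbb Q[x_1,\dots,x_r]$ be the span of the monomials $x_1^{m_1-1}\cdots x_r^{m_r-1}$ with $(m_1,\dots,m_r)\in S_{N,r}$, and let $\pi:\mathbf V_{N,r}\to\mathsf{Vect}_{N,r}$ be the isomorphism sending a polynomial to its vector of coefficients. For $r\ge 2$ put $$\mathbf W_{N,r}=\{P\in\mathbf V_{N,r} : P(x_1,\dots,x_r)=P(x_2-x_1,x_2,x_3,\dots,x_r)-P(x_2-x_1,x_1,x_3,\dots,x_r)\}.$$ For $f=x_1^d$ and a polynomial $g$ in $r-1$ variables put $$(f\mathbin{\underline\circ}g)(x_1,\dots,x_r)=f(x_1)g(x_2,\dots,x_r)+\sum_{i=1}^{r-1}\Bigl(f(x_{i+1}-x_i)\,g(x_1,\dots,\widehat{x_{i+1}},\dots,x_r)-(-1)^{d}f(x_i-x_{i+1})\,g(x_1,\dots,\widehat{x_i},\dots,x_r)\Bigr),$$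 and let $e\binom{m_1,\dots,m_r}{n_1,\dots,n_r}$ be the coefficient of $x_1^{n_1-1}\cdots x_r^{n_r-1}$ in $x_1^{m_1-1}\mathbin{\underline\circ}(x_1^{m_2-1}\cdots x_{r-1}^{m_r-1})$. Define the following matrices with rows $m$ and columns $n$ in $S_{N,r}$: $$E_{N,r}=\Bigl(e\tbinom{m_1,\dots,m_r}{n_1,\dots,n_r}\Bigr)_{m,n},\qquad E_{N,r}^{(j)}=\Bigl(\delta_{(m_1,\dots,m_{r-j}),(n_1,\dots,n_{r-j})}\;e\tbinom{m_{r-j+1},\dots,m_r}{n_{r-j+1},\dots,n_r}\Bigr)_{m,n}\quad(2\le j\le r),$$ $$F_{N,r}=E_{N,r}-\mathrm{id},\qquad C_{N,r}=E_{N,r}^{(2)}E_{N,r}^{(3)}\cdots E_{N,r}^{(r-1)}E_{N,r}.$$ Tasaka's map is the $\mathbb Q$-linear map $\mathbf W_{N,r}\to\ker{}^tE_{N,r}\subseteq\mathsf{Vect}_{N,r}$, $P\mapsto\pi(P)F_{N,r}$. **Theorem.** Let $N$ be a natural number and assume that Tasaka's map for this $N$ and $r=3$ is injective. Then $\dim_{\mathbb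 Q}\ker C_{N,3}$ (the kernel being the space of right annihilators of $C_{N,3}$) is at least the coefficient of $x^N$ in $2\,\mathbb O(x)\,\mathbb S(x)$, where $$\mathbb O(x)=\frac{x^3}{1-x^2},\qquad \mathbb S(x)=\frac{x^{12}}{(1-x^4)(1-x^6)}.$$ In particular, if Tasaka's map is injective for all $N>0$ and $r\geq 2$, then $\sum_{N>0}\dim_{\mathbb Q}\ker C_{N,3}\,x^N\ge 2\,\mathbb O(x)\mathbb S(x)$ coefficientwise. -/

import Mathlib

namespace OddMZV

noncomputable section

open MvPolynomial

/-- The index set `S_{N,r}`: tuples of `r` odd integers `≥ 3` with sum `N`. -/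
def S (N r : ℕ) : Finset (Fin r → ℕ) :=
  (Finset.Nat.antidiagonalTuple r N).filter fun n => ∀ i, 3 ≤ n i ∧ Odd (n i)

/-- The exponent vector `(n₁ - 1, …, n_r - 1)` of the monomial attached to `(n₁, …, n_r)`
(used for entries `≥ 1` only). -/
def expo {r : ℕ} (n : Fin r → ℕ) : Fin r →₀ ℕ :=
  Finsupp.equivFunOnFinite.symm fun i => n i - 1

/-- `V_{N,r}`: the span of the monomials `x₁^{m₁-1} ⋯ x_r^{m_r-1}`, `m ∈ S_{N,r}`. -/
def V (N r : ℕ) : Submodule ℚ (MvPolynomial (Fin r) ℚ) :=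
  Submodule.span ℚ ((fun m => monomial (expo m) (1 : ℚ)) '' (S N r : Set (Fin r → ℕ)))

/-- The space `Vect_{N,r}` of (row) vectors indexed by `S_{N,r}`. -/
abbrev Vect (N r : ℕ) : Type := S N r → ℚ

/-- The isomorphism `π : V_{N,r} → Vect_{N,r}` reading off the coefficients. -/
def piMap (N r : ℕ) : V N r →ₗ[ℚ] Vect N r :=
  LinearMap.pi fun n => (MvPolynomial.lcoeff ℚ (expo n.1)).comp (V N r).subtype

/-- The substitution `P ↦ P(x₂ - x₁, x₂, x₃, …, x_r)`. -/
def substA {r : ℕ} (hr : 2 ≤ r) : MvPolynomial (Fin r) ℚ →ₐ[ℚ] MvPolynomial (Fin r) ℚ :=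
  aeval fun i => if i = ⟨0, by omega⟩ then X ⟨1, by omega⟩ - X ⟨0, by omega⟩ else X i

/-- The substitution `P ↦ P(x₂ - x₁, x₁, x₃, …, x_r)`. -/
def substB {r : ℕ} (hr : 2 ≤ r) : MvPolynomial (Fin r) ℚ →ₐ[ℚ] MvPolynomial (Fin r) ℚ :=
  aeval fun i =>
    if i = ⟨0, by omega⟩ then X ⟨1, by omega⟩ - X ⟨0, by omega⟩
    else if i = ⟨1, by omega⟩ then X ⟨0, by omega⟩
    else X i

/-- `W_{N,r}`: all `P ∈ V_{N,r}` with
`P(x₁, …, x_r) = P(x₂ - x₁, x₂, x₃, …, x_r) - P(x₂ - x₁, x₁, x₃, …, x_r)`. -/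
def W (N r : ℕ) (hr : 2 ≤ r) : Submodule ℚ (MvPolynomial (Fin r) ℚ) :=
  V N r ⊓ LinearMap.eqLocus LinearMap.id ((substA hr).toLinearMap - (substB hr).toLinearMap)

/-- The Ihara action `f ∘ g` for homogeneous `f` in one variable and `g` in `s` variables; the
result has `s + 1` variables. `Fin.succAbove k` enumerates the variables with the `k`-th one
omitted. -/
def ihara {s : ℕ} (f : Polynomial ℚ) (g : MvPolynomial (Fin s) ℚ) :
    MvPolynomial (Fin (s + 1)) ℚ :=
  Polynomial.aeval (X 0) f * rename Fin.succ g +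
    ∑ i : Fin s,
      (Polynomial.aeval (X i.succ - X i.castSucc) f * rename i.succ.succAbove g -
        (-1) ^ f.natDegree *
          (Polynomial.aeval (X i.castSucc - X i.succ) f * rename i.castSucc.succAbove g))

/-- The number `e(m₁,…,m_r; n₁,…,n_r)`: the coefficient of `x₁^{n₁-1} ⋯ x_r^{n_r-1}` in
`x₁^{m₁-1} ∘ (x₁^{m₂-1} ⋯ x_{r-1}^{m_r-1})`. The value for `r = 0` is never used. -/
def e : {r : ℕ} → (Fin r → ℕ) → (Fin r → ℕ) → ℚ
  | 0, _, _ => 0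
  | _ + 1, m, n =>
      coeff (expo n) (ihara (Polynomial.X ^ (m 0 - 1)) (monomial (expo (Fin.tail m)) 1))

/-- The matrix `E_{N,r}`. -/
def E (N r : ℕ) : Matrix (S N r) (S N r) ℚ :=
  Matrix.of fun m n => e m.1 n.1

/-- The last `j` entries `(m_{r-j+1}, …, m_r)` of `(m₁, …, m_r)`. -/
def lastPart {r : ℕ} (j : ℕ) (hj : j ≤ r) (m : Fin r → ℕ) : Fin j → ℕ :=
  fun i => m ⟨r - j + i, by omega⟩

/-- The matrix `E_{N,r}^{(j)}`: Kronecker delta on the first `r - j` entries, `e` on the last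
`j` entries. -/
def Ej (N r j : ℕ) (hj : j ≤ r) : Matrix (S N r) (S N r) ℚ :=
  Matrix.of fun m n =>
    (if ∀ i : Fin r, (i : ℕ) < r - j → m.1 i = n.1 i then 1 else 0) *
      e (lastPart j hj m.1) (lastPart j hj n.1)

/-- The matrix `C_{N,r} = E_{N,r}^{(2)} ⋯ E_{N,r}^{(r-1)} E_{N,r}`. -/
def C (N r : ℕ) : Matrix (S N r) (S N r) ℚ :=
  (List.ofFn fun i : Fin (r - 2) => Ej N r (i + 2) (by omega)).prod * E N r

/-- The matrix `F_{N,r} = E_{N,r} - id`. -/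
def F (N r : ℕ) : Matrix (S N r) (S N r) ℚ := E N r - 1

/-- Tasaka's map `W_{N,r} → Vect_{N,r}`, `P ↦ π(P) F_{N,r}`. Its image lies in the left kernel of
`E_{N,r}`; whether it is injective does not depend on this choice of codomain. -/
def tasakaMap (N r : ℕ) (hr : 2 ≤ r) : W N r hr →ₗ[ℚ] Vect N r :=
  (F N r).vecMulLinear ∘ₗ piMap N r ∘ₗ Submodule.inclusion inf_le_left

/-- `O(x) = x³ / (1 - x²)`. -/
def seriesO : PowerSeries ℚ := PowerSeries.X ^ 3 * (1 - PowerSeries.X ^ 2)⁻¹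

/-- `S(x) = x¹² / ((1 - x⁴)(1 - x⁶))`. -/
def seriesS : PowerSeries ℚ :=
  PowerSeries.X ^ 12 * ((1 - PowerSeries.X ^ 4) * (1 - PowerSeries.X ^ 6))⁻¹

end

end OddMZV

namespace OddMZV

open MvPolynomial

noncomputable section

/-! Since `C N 3` is the product of E^(2) and E and is square, it suffices to find many row vectors
`v` with `v` E^(2) E = 0. Row vectors are read as polynomials in V, and right multiplication by E
and E^(2) as the substitution operators `theta` and `thetaTwo`, followed by taking coefficients.

Two copies of W then lie in the left kernel. For P in W the relation collapses `theta P` to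
`lastDiff P`, while `thetaTwo P = P - lastDiff P`; hence E^(2) acts on π(P) as -F, and π(P) F E = 0
(`coeffVec_vecMul_Ej_two_eq_neg`, `coeffVec_vecMul_F_vecMul_E`). For the rotated polynomial `cyc P`,
already π(`cyc P`) E^(2) = 0. Multiplying by E^(2) thus kills the second copy and is minus Tasaka's
map on the first, so injectivity of that map makes the sum direct.

It remains to bound dim W from below. Even period polynomials in x₁, x₂ times even powers of x₃ lie
in W. The period relation says that a rotation sum of degree 2n vanishes; this sum is anti-invariant
under the anharmonic group, so it vanishes identically once it vanishes at n/3 suitable points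
(`rotSum_one_X_eq_zero`). Counting unknowns against conditions gives the coefficients of 𝕊, and
summing over the power of x₃ gives 𝕆𝕊. -/

/-! ### Substitutions and scalings of variables -/

/-- The substitution `P ↦ P(u, v, w)`. -/
def subst3 (u v w : MvPolynomial (Fin 3) ℚ) :
    MvPolynomial (Fin 3) ℚ →ₐ[ℚ] MvPolynomial (Fin 3) ℚ :=
  aeval ![u, v, w]

lemma eval_subst3 (x : Fin 3 → ℚ) (u v w P : MvPolynomial (Fin 3) ℚ) :
    eval x (subst3 u v w P) = eval ![eval x u, eval x v, eval x w] P := by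
  have : (eval x).comp (subst3 u v w).toRingHom = eval ![eval x u, eval x v, eval x w] := by
    apply MvPolynomial.ringHom_ext
    · intro r; simp [subst3]
    · intro i; fin_cases i <;> simp [subst3]
  exact congrArg (fun f => f P) this

/-- Multiplication of the `i`-th variable by the scalar `t`. -/
def scale (i : Fin 3) (t : ℚ) : MvPolynomial (Fin 3) ℚ →ₐ[ℚ] MvPolynomial (Fin 3) ℚ :=
  aeval fun j => if j = i then MvPolynomial.C t * X j else X j

lemma scale_monomial (i : Fin 3) (t : ℚ) (d : Fin 3 →₀ ℕ) (a : ℚ) :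
    scale i t (monomial d a) = monomial d (t ^ d i * a) := by
  have h : (d.prod fun j k => (if j = i then MvPolynomial.C t * X j else X j : MvPolynomial (Fin 3) ℚ) ^ k) =
      MvPolynomial.C (t ^ d i) * d.prod fun j k => (X j : MvPolynomial (Fin 3) ℚ) ^ k := by
    rw [Finsupp.prod_fintype _ _ (by simp), Finsupp.prod_fintype _ _ (by simp)]
    have : ∀ j, (if j = i then MvPolynomial.C t * X j else X j : MvPolynomial (Fin 3) ℚ) ^ d j =
        (if j = i then MvPolynomial.C (t ^ d i) else 1) * X j ^ d j := by
      intro j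
      split_ifs with h
      · subst h; rw [mul_pow, C_pow]
      · rw [one_mul]
    simp_rw [this]
    rw [Finset.prod_mul_distrib]
    simp
  rw [scale, aeval_monomial, h, monomial_eq (a := t ^ d i * a), C_mul, MvPolynomial.algebraMap_eq]
  ring

lemma coeff_scale (i : Fin 3) (t : ℚ) (d : Fin 3 →₀ ℕ) (P : MvPolynomial (Fin 3) ℚ) :
    coeff d (scale i t P) = t ^ d i * coeff d P := by
  induction P using MvPolynomial.induction_on' with
  | monomial u a =>
    rw [scale_monomial, coeff_monomial, coeff_monomial]
    split_ifs with h
    · rw [h]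
    · simp
  | add p q hp hq => rw [map_add, coeff_add, coeff_add, hp, hq]; ring

lemma eval_scale (x : Fin 3 → ℚ) (i : Fin 3) (t : ℚ) (P : MvPolynomial (Fin 3) ℚ) :
    eval x (scale i t P) = eval (Function.update x i (t * x i)) P := by
  have : (eval x).comp (scale i t).toRingHom = eval (Function.update x i (t * x i)) := by
    apply MvPolynomial.ringHom_ext
    · intro r; simp [scale]
    · intro j
      by_cases h : j = i
      · subst h; simp [scale]
      · simp [scale, h]
  exact congrArg (fun f => f P) this

/-! ### The space V and its coefficient vectors -/

lemma mem_S {N r : ℕ} {n : Fin r → ℕ} :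
    n ∈ S N r ↔ ∑ i, n i = N ∧ ∀ i, 3 ≤ n i ∧ Odd (n i) := by
  simp [S, Finset.Nat.mem_antidiagonalTuple]

@[simp] lemma expo_apply {r : ℕ} (n : Fin r → ℕ) (i : Fin r) : expo n i = n i - 1 := rfl

lemma mem_V_iff {N r : ℕ} {P : MvPolynomial (Fin r) ℚ} :
    P ∈ V N r ↔ ∀ d, coeff d P ≠ 0 → ∃ m ∈ S N r, expo m = d := by
  have : V N r = restrictSupport ℚ (expo '' (S N r : Set (Fin r → ℕ))) := by
    rw [restrictSupport_eq_span, V, Set.image_image]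
  rw [this, mem_restrictSupport_iff]
  simp only [Set.subset_def, Finset.mem_coe, mem_support_iff, Set.mem_image]

lemma scale_neg_one_of_mem_V {N : ℕ} {P : MvPolynomial (Fin 3) ℚ} (hP : P ∈ V N 3) (i : Fin 3) :
    scale i (-1) P = P := by
  ext d
  rw [coeff_scale]
  by_cases h : coeff d P = 0
  · simp [h]
  · obtain ⟨m, hm, rfl⟩ := mem_V_iff.1 hP d h
    obtain ⟨-, hodd⟩ := (mem_S.1 hm).2 i
    rw [expo_apply, Even.neg_one_pow (by obtain ⟨k, hk⟩ := hodd; exact ⟨k, by omega⟩), one_mul]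

lemma scale_zero_of_mem_V {N : ℕ} {P : MvPolynomial (Fin 3) ℚ} (hP : P ∈ V N 3) (i : Fin 3) :
    scale i 0 P = 0 := by
  ext d
  rw [coeff_scale, coeff_zero]
  by_cases h : coeff d P = 0
  · simp [h]
  · obtain ⟨m, hm, rfl⟩ := mem_V_iff.1 hP d h
    have := ((mem_S.1 hm).2 i).1
    rw [expo_apply, zero_pow (by omega), zero_mul]

lemma isHomogeneous_of_mem_V {N : ℕ} {P : MvPolynomial (Fin 3) ℚ} (hP : P ∈ V N 3) :
    P.IsHomogeneous (N - 3) := by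
  intro d h
  obtain ⟨m, hm, rfl⟩ := mem_V_iff.1 hP d h
  obtain ⟨hs, h3⟩ := mem_S.1 hm
  rw [Finsupp.weight_apply, Finsupp.sum_fintype _ _ (by simp)]
  simp only [Fin.sum_univ_three, expo_apply, Pi.one_apply, smul_eq_mul, mul_one] at hs ⊢
  have := h3 0; have := h3 1; have := h3 2
  omega

lemma mem_V_of_symmetric {N : ℕ} {P : MvPolynomial (Fin 3) ℚ} (hh : P.IsHomogeneous (N - 3))
    (hneg : ∀ i, scale i (-1) P = P) (hzero : ∀ i, scale i 0 P = 0) : P ∈ V N 3 := by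
  refine mem_V_iff.2 fun d h => ⟨fun i => d i + 1, ?_, ?_⟩
  · have hev : ∀ i, Even (d i) := by
      intro i
      by_contra hodd
      have h1 := congrArg (coeff d) (hneg i)
      rw [coeff_scale, (Nat.not_even_iff_odd.1 hodd).neg_one_pow] at h1
      exact h (by linarith)
    have hpos : ∀ i, d i ≠ 0 := by
      intro i h0
      have h1 := congrArg (coeff d) (hzero i)
      rw [coeff_scale, h0] at h1
      exact h (by simpa using h1)
    have hd := hh h
    rw [Finsupp.weight_apply, Finsupp.sum_fintype _ _ (by simp)] at hd
    simp only [Fin.sum_univ_three, Pi.one_apply, smul_eq_mul, mul_one] at hd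
    have h2 : ∀ i, 2 ≤ d i := fun i => by
      obtain ⟨k, hk⟩ := hev i
      have := hpos i
      omega
    refine mem_S.2 ⟨?_, fun i => ⟨by have := h2 i; omega, (hev i).add_one⟩⟩
    have := h2 0; have := h2 1; have := h2 2
    simp only [Fin.sum_univ_three]
    omega
  · ext i; simp

/-- The vector of the coefficients of a polynomial at the monomials indexed by `S_{N,3}`. -/
def coeffVec (N : ℕ) : MvPolynomial (Fin 3) ℚ →ₗ[ℚ] Vect N 3 :=
  LinearMap.pi fun n => MvPolynomial.lcoeff ℚ (expo n.1)

@[simp] lemma coeffVec_apply (N : ℕ) (P : MvPolynomial (Fin 3) ℚ) (n : S N 3) :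
    coeffVec N P n = coeff (expo n.1) P := rfl

/-- The exponents read off by `coeffVec` are even and positive. It therefore ignores whatever is odd
in some variable and, by the next lemma, whatever does not involve some variable. -/
lemma coeffVec_scale_neg_one (N : ℕ) (i : Fin 3) (P : MvPolynomial (Fin 3) ℚ) :
    coeffVec N (scale i (-1) P) = coeffVec N P := by
  ext n
  obtain ⟨-, hodd⟩ := (mem_S.1 n.2).2 i
  rw [coeffVec_apply, coeffVec_apply, coeff_scale, expo_apply,
    Even.neg_one_pow (by obtain ⟨k, hk⟩ := hodd; exact ⟨k, by omega⟩), one_mul]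

lemma coeffVec_eq_zero_of_scale_zero (N : ℕ) (i : Fin 3) {P : MvPolynomial (Fin 3) ℚ}
    (h : scale i 0 P = P) : coeffVec N P = 0 := by
  ext n
  have := ((mem_S.1 n.2).2 i).1
  rw [coeffVec_apply, ← h, coeff_scale, expo_apply, zero_pow (by omega), zero_mul, Pi.zero_apply]

lemma expo_injOn {N r : ℕ} {m n : Fin r → ℕ} (hm : m ∈ S N r) (hn : n ∈ S N r)
    (h : expo m = expo n) : m = n := by
  ext i
  have h1 := DFunLike.congr_fun h i
  have := (mem_S.1 hm).2 i; have := (mem_S.1 hn).2 i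
  simp only [expo_apply] at h1
  omega

lemma coeffVec_monomial (N : ℕ) (m : S N 3) :
    coeffVec N (monomial (expo m.1) 1) = Pi.single m 1 := by
  ext n
  rw [coeffVec_apply, coeff_monomial, Pi.single_apply]
  congr 1
  refine propext ⟨fun h => Subtype.ext (expo_injOn n.2 m.2 h.symm), fun h => by rw [h]⟩

lemma eq_zero_of_coeffVec_eq_zero {N : ℕ} {P : MvPolynomial (Fin 3) ℚ} (hP : P ∈ V N 3)
    (h : coeffVec N P = 0) : P = 0 := by
  ext d
  by_contra hd
  obtain ⟨m, hm, rfl⟩ := mem_V_iff.1 hP d hd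
  exact hd (congrFun h ⟨m, hm⟩)

/-! ### The matrices as operators on polynomials -/

/-- The polynomial form of right multiplication by `E_{N,3}`. -/
def theta : MvPolynomial (Fin 3) ℚ →ₗ[ℚ] MvPolynomial (Fin 3) ℚ :=
  LinearMap.id + (subst3 (X 1 - X 0) (X 0) (X 2)).toLinearMap -
    (subst3 (X 1 - X 0) (X 1) (X 2)).toLinearMap +
    (subst3 (X 2 - X 1) (X 0) (X 1)).toLinearMap -
    (subst3 (X 2 - X 1) (X 0) (X 2)).toLinearMap

/-- The polynomial form of right multiplication by `E_{N,3}^{(2)}`. -/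
def thetaTwo : MvPolynomial (Fin 3) ℚ →ₗ[ℚ] MvPolynomial (Fin 3) ℚ :=
  LinearMap.id + (subst3 (X 0) (X 2 - X 1) (X 1)).toLinearMap -
    (subst3 (X 0) (X 2 - X 1) (X 2)).toLinearMap

lemma vecMul_eq_coeffVec_of_monomial {N : ℕ} {M : Matrix (S N 3) (S N 3) ℚ}
    {f : MvPolynomial (Fin 3) ℚ →ₗ[ℚ] MvPolynomial (Fin 3) ℚ}
    (h : ∀ m n : S N 3, M m n = coeff (expo n.1) (f (monomial (expo m.1) 1)))
    {P : MvPolynomial (Fin 3) ℚ} (hP : P ∈ V N 3) :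
    Matrix.vecMul (coeffVec N P) M = coeffVec N (f P) := by
  have : Set.EqOn (M.vecMulLinear ∘ₗ coeffVec N) (coeffVec N ∘ₗ f)
      ((fun m => monomial (expo m) (1 : ℚ)) '' (S N 3 : Set (Fin 3 → ℕ))) := by
    rintro _ ⟨m, hm, rfl⟩
    ext n
    have := coeffVec_monomial N ⟨m, hm⟩
    simp only [LinearMap.comp_apply, Matrix.vecMulLinear_apply] at this ⊢
    rw [this, Matrix.single_one_vecMul]
    exact h ⟨m, hm⟩ n
  exact LinearMap.eqOn_span this hP

lemma eval_monomial_expo {r : ℕ} (x : Fin r → ℚ) (m : Fin r → ℕ) :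
    eval x (monomial (expo m) 1) = ∏ i, x i ^ (m i - 1) := by
  rw [eval_monomial, one_mul, Finsupp.prod_fintype _ _ (by simp)]
  rfl

/-- The exponent `m 0 - 1` is even, so the sign in the Ihara action is 1 and the differences of
variables may be reversed. -/
lemma ihara_eq_theta {m : Fin 3 → ℕ} (hm : Odd (m 0)) :
    ihara (Polynomial.X ^ (m 0 - 1)) (monomial (expo (Fin.tail m)) 1) =
      theta (monomial (expo m) 1) := by
  have hev : Even (m 0 - 1) := by obtain ⟨k, hk⟩ := hm; exact ⟨k, by omega⟩
  refine MvPolynomial.funext (σ := Fin 3) fun x => ?_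
  simp only [ihara, theta, Polynomial.natDegree_X_pow, hev.neg_one_pow, LinearMap.add_apply,
    LinearMap.sub_apply, LinearMap.id_apply, AlgHom.toLinearMap_apply, map_add, map_sub,
    map_mul, map_pow, Polynomial.aeval_X, eval_X, eval_rename, eval_subst3, eval_monomial_expo,
    Fin.sum_univ_two, Fin.prod_univ_two, Fin.prod_univ_three, one_mul]
  simp only [Fin.tail, Function.comp_apply, Matrix.cons_val]
  have s1 : (Fin.succ 0 : Fin 3) = 1 := rfl
  have s2 : (Fin.succ 1 : Fin 3) = 2 := rfl
  have c1 : (Fin.castSucc 0 : Fin 3) = 0 := rfl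
  have c2 : (Fin.castSucc 1 : Fin 3) = 1 := rfl
  have a00 : Fin.succAbove (0 : Fin 3) 0 = 1 := rfl
  have a01 : Fin.succAbove (0 : Fin 3) 1 = 2 := rfl
  have a10 : Fin.succAbove (1 : Fin 3) 0 = 0 := rfl
  have a11 : Fin.succAbove (1 : Fin 3) 1 = 2 := rfl
  have a20 : Fin.succAbove (2 : Fin 3) 0 = 0 := rfl
  have a21 : Fin.succAbove (2 : Fin 3) 1 = 1 := rfl
  simp only [s1, s2, c1, c2, a00, a01, a10, a11, a20, a21]
  have e1 : (x 0 - x 1) ^ (m 0 - 1) = (x 1 - x 0) ^ (m 0 - 1) := by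
    rw [← neg_sub, hev.neg_pow]
  have e2 : (x 1 - x 2) ^ (m 0 - 1) = (x 2 - x 1) ^ (m 0 - 1) := by
    rw [← neg_sub, hev.neg_pow]
  rw [e1, e2]
  ring

lemma coeffVec_vecMul_E {N : ℕ} {P : MvPolynomial (Fin 3) ℚ} (hP : P ∈ V N 3) :
    Matrix.vecMul (coeffVec N P) (E N 3) = coeffVec N (theta P) := by
  refine vecMul_eq_coeffVec_of_monomial (fun m n => ?_) hP
  rw [← ihara_eq_theta ((mem_S.1 m.2).2 0).2]
  rfl

lemma finSuccEquiv_rename_succ {r : ℕ} (q : MvPolynomial (Fin r) ℚ) :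
    MvPolynomial.finSuccEquiv ℚ r (rename Fin.succ q) = Polynomial.C q := by
  induction q using MvPolynomial.induction_on with
  | C a => simp [finSuccEquiv_apply]
  | add p q hp hq => simp [hp, hq]
  | mul_X p i hp => simp [hp, finSuccEquiv_X_succ]

/-- The Kronecker delta in `Ej` on the first entry amounts to an inert factor in x₁. -/
lemma coeff_X_zero_pow_mul_rename_succ {r : ℕ} (a : ℕ) (q : MvPolynomial (Fin r) ℚ)
    (n : Fin (r + 1) → ℕ) :
    coeff (expo n) (X 0 ^ a * rename Fin.succ q) =
      if a = n 0 - 1 then coeff (expo (Fin.tail n)) q else 0 := by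
  have h : expo n = (expo (Fin.tail n)).cons (n 0 - 1) := by
    ext i
    refine Fin.cases ?_ (fun j => ?_) i <;> simp [Fin.tail]
  rw [h, ← finSuccEquiv_coeff_coeff, map_mul, map_pow, finSuccEquiv_X_zero,
    finSuccEquiv_rename_succ, Polynomial.coeff_mul_C, Polynomial.coeff_X_pow]
  simp only [eq_comm (a := n 0 - 1)]
  split_ifs <;> simp

lemma ihara_eq_thetaTwo {m : Fin 3 → ℕ} (hm : Odd (m 1)) :
    X 0 ^ (m 0 - 1) * rename Fin.succ
      (ihara (Polynomial.X ^ (m 1 - 1)) (monomial (expo (fun _ : Fin 1 => m 2)) 1)) =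
      thetaTwo (monomial (expo m) 1) := by
  have hev : Even (m 1 - 1) := by obtain ⟨k, hk⟩ := hm; exact ⟨k, by omega⟩
  refine MvPolynomial.funext (σ := Fin 3) fun x => ?_
  simp only [ihara, thetaTwo, Polynomial.natDegree_X_pow, hev.neg_one_pow, LinearMap.add_apply,
    LinearMap.sub_apply, LinearMap.id_apply, AlgHom.toLinearMap_apply, map_add, map_sub,
    map_mul, map_pow, Polynomial.aeval_X, eval_X, eval_rename, eval_subst3, eval_monomial_expo,
    Finset.univ_unique, Finset.sum_singleton, Finset.prod_singleton, Fin.default_eq_zero,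
    Fin.prod_univ_three, one_mul]
  have s0 : (Fin.succ 0 : Fin 2) = 1 := rfl
  have s1 : (Fin.succ 0 : Fin 3) = 1 := rfl
  have s2 : (Fin.succ 1 : Fin 3) = 2 := rfl
  have c1 : (Fin.castSucc 0 : Fin 2) = 0 := rfl
  have a00 : Fin.succAbove (0 : Fin 2) 0 = 1 := rfl
  have a10 : Fin.succAbove (1 : Fin 2) 0 = 0 := rfl
  simp only [Function.comp_apply, s0, s1, s2, c1, a00, a10, Matrix.cons_val]
  have e1 : (x 1 - x 2) ^ (m 1 - 1) = (x 2 - x 1) ^ (m 1 - 1) := by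
    rw [← neg_sub, hev.neg_pow]
  rw [e1]
  ring

lemma coeffVec_vecMul_Ej_two {N : ℕ} {P : MvPolynomial (Fin 3) ℚ} (hP : P ∈ V N 3) :
    Matrix.vecMul (coeffVec N P) (Ej N 3 2 (by norm_num)) = coeffVec N (thetaTwo P) := by
  refine vecMul_eq_coeffVec_of_monomial (fun m n => ?_) hP
  rw [← ihara_eq_thetaTwo ((mem_S.1 m.2).2 1).2, coeff_X_zero_pow_mul_rename_succ]
  have h : (∀ i : Fin 3, (i : ℕ) < 3 - 2 → m.1 i = n.1 i) ↔ m.1 0 - 1 = n.1 0 - 1 := by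
    have := (mem_S.1 m.2).2 0; have := (mem_S.1 n.2).2 0
    constructor
    · intro h; rw [h 0 (by norm_num)]
    · intro h i hi
      have : i = 0 := Fin.ext (by simpa using hi)
      subst this; omega
  have ht : lastPart 2 (by norm_num) n.1 = Fin.tail n.1 := by
    ext i; fin_cases i <;> rfl
  have hm : Fin.tail (lastPart 2 (by norm_num : 2 ≤ 3) m.1) = fun _ : Fin 1 => m.1 2 := by
    ext i; fin_cases i; rfl
  simp only [Ej, Matrix.of_apply, h, e]
  rw [ht, hm]
  split_ifs
  · rw [one_mul]; rfl
  · rw [zero_mul]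

/-! ### Membership in V and W through values -/

lemma update_vec_zero (a b c t : ℚ) : Function.update ![a, b, c] 0 t = ![t, b, c] := by
  ext i; fin_cases i <;> rfl

lemma update_vec_one (a b c t : ℚ) : Function.update ![a, b, c] 1 t = ![a, t, c] := by
  ext i; fin_cases i <;> rfl

lemma update_vec_two (a b c t : ℚ) : Function.update ![a, b, c] 2 t = ![a, b, t] := by
  ext i; fin_cases i <;> rfl

lemma eval_scale_zero (a b c t : ℚ) (P : MvPolynomial (Fin 3) ℚ) :
    eval ![a, b, c] (scale 0 t P) = eval ![t * a, b, c] P := by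
  rw [eval_scale, update_vec_zero]; rfl

lemma eval_scale_one (a b c t : ℚ) (P : MvPolynomial (Fin 3) ℚ) :
    eval ![a, b, c] (scale 1 t P) = eval ![a, t * b, c] P := by
  rw [eval_scale, update_vec_one]; rfl

lemma eval_scale_two (a b c t : ℚ) (P : MvPolynomial (Fin 3) ℚ) :
    eval ![a, b, c] (scale 2 t P) = eval ![a, b, t * c] P := by
  rw [eval_scale, update_vec_two]; rfl

lemma funext_vec {P Q : MvPolynomial (Fin 3) ℚ}
    (h : ∀ a b c, eval ![a, b, c] P = eval ![a, b, c] Q) : P = Q := by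
  refine MvPolynomial.funext fun x => ?_
  have : x = ![x 0, x 1, x 2] := by ext i; fin_cases i <;> rfl
  rw [this]
  exact h _ _ _

/-- The polynomials of `V_{N,3}`, seen as functions: even in each variable and vanishing on the
coordinate planes. -/
structure IsEvenVanishing (p : ℚ → ℚ → ℚ → ℚ) : Prop where
  neg_fst : ∀ a b c, p (-a) b c = p a b c
  neg_snd : ∀ a b c, p a (-b) c = p a b c
  neg_trd : ∀ a b c, p a b (-c) = p a b c
  zero_fst : ∀ b c, p 0 b c = 0
  zero_snd : ∀ a c, p a 0 c = 0
  zero_trd : ∀ a b, p a b 0 = 0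

lemma isEvenVanishing_of_mem_V {N : ℕ} {P : MvPolynomial (Fin 3) ℚ} (hP : P ∈ V N 3) :
    IsEvenVanishing fun a b c => eval ![a, b, c] P where
  neg_fst a b c := by
    conv_rhs => rw [← scale_neg_one_of_mem_V hP 0, eval_scale_zero, neg_one_mul]
  neg_snd a b c := by
    conv_rhs => rw [← scale_neg_one_of_mem_V hP 1, eval_scale_one, neg_one_mul]
  neg_trd a b c := by
    conv_rhs => rw [← scale_neg_one_of_mem_V hP 2, eval_scale_two, neg_one_mul]
  zero_fst b c := by
    rw [← zero_mul (0 : ℚ), ← eval_scale_zero, scale_zero_of_mem_V hP, map_zero, zero_mul]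
  zero_snd a c := by
    rw [← zero_mul (0 : ℚ), ← eval_scale_one, scale_zero_of_mem_V hP, map_zero, zero_mul]
  zero_trd a b := by
    rw [← zero_mul (0 : ℚ), ← eval_scale_two, scale_zero_of_mem_V hP, map_zero, zero_mul]

lemma mem_V_of_isEvenVanishing {N : ℕ} {P : MvPolynomial (Fin 3) ℚ}
    (hh : P.IsHomogeneous (N - 3)) (h : IsEvenVanishing fun a b c => eval ![a, b, c] P) :
    P ∈ V N 3 := by
  refine mem_V_of_symmetric hh (fun i => funext_vec fun a b c => ?_)
    (fun i => funext_vec fun a b c => ?_)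
  · fin_cases i
    · exact (eval_scale_zero a b c _ P).trans (by rw [neg_one_mul]; exact h.neg_fst a b c)
    · exact (eval_scale_one a b c _ P).trans (by rw [neg_one_mul]; exact h.neg_snd a b c)
    · exact (eval_scale_two a b c _ P).trans (by rw [neg_one_mul]; exact h.neg_trd a b c)
  · rw [map_zero]
    fin_cases i
    · exact (eval_scale_zero a b c _ P).trans (by rw [zero_mul]; exact h.zero_fst b c)
    · exact (eval_scale_one a b c _ P).trans (by rw [zero_mul]; exact h.zero_snd a c)
    · exact (eval_scale_two a b c _ P).trans (by rw [zero_mul]; exact h.zero_trd a b)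

lemma mem_W_iff {N : ℕ} {P : MvPolynomial (Fin 3) ℚ} (hr : 2 ≤ 3) :
    P ∈ W N 3 hr ↔ P ∈ V N 3 ∧ ∀ a b c : ℚ, eval ![a, b, c] P =
      eval ![b - a, b, c] P - eval ![b - a, a, c] P := by
  have hA : substA hr = subst3 (X 1 - X 0) (X 1) (X 2) := by
    refine MvPolynomial.algHom_ext fun i => ?_
    fin_cases i <;> simp [substA, subst3]
  have hB : substB hr = subst3 (X 1 - X 0) (X 0) (X 2) := by
    refine MvPolynomial.algHom_ext fun i => ?_
    fin_cases i <;> simp [substB, subst3]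
  rw [W, Submodule.mem_inf, LinearMap.mem_eqLocus, hA, hB]
  refine and_congr_right fun _ => ⟨fun h a b c => ?_, fun h => funext_vec fun a b c => ?_⟩
  · have := congrArg (eval ![a, b, c]) h
    simpa [eval_subst3] using this
  · simpa [eval_subst3] using h a b c

lemma isHomogeneous_subst3 {n : ℕ} {P u v w : MvPolynomial (Fin 3) ℚ} (hP : P.IsHomogeneous n)
    (hu : u.IsHomogeneous 1) (hv : v.IsHomogeneous 1) (hw : w.IsHomogeneous 1) :
    (subst3 u v w P).IsHomogeneous n := by
  rw [← one_mul n]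
  refine hP.aeval _ fun i => ?_
  fin_cases i
  exacts [hu, hv, hw]

/-! ### The first copy of W in the left kernel -/

/-- `P(x₁, x₃ - x₂, x₃) - P(x₁, x₃ - x₂, x₂)`. -/
def lastDiff (P : MvPolynomial (Fin 3) ℚ) : MvPolynomial (Fin 3) ℚ :=
  subst3 (X 0) (X 2 - X 1) (X 2) P - subst3 (X 0) (X 2 - X 1) (X 1) P

/-- The part of `P(x₁, x₃ - x₂, x₃) - P(x₁, x₃ - x₂, x₂)` supported on monomials with positive
even exponents. -/
def evenLastDiff (P : MvPolynomial (Fin 3) ℚ) : MvPolynomial (Fin 3) ℚ :=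
  (1 / 2 : ℚ) • (lastDiff P + scale 1 (-1) (lastDiff P)) -
    subst3 (X 0) (X 2) (X 2) P + subst3 (X 0) (X 1) (X 1) P

lemma eval_lastDiff (P : MvPolynomial (Fin 3) ℚ) (a b c : ℚ) :
    eval ![a, b, c] (lastDiff P) = eval ![a, c - b, c] P - eval ![a, c - b, b] P := by
  simp [lastDiff, eval_subst3]

lemma eval_evenLastDiff (P : MvPolynomial (Fin 3) ℚ) (a b c : ℚ) :
    eval ![a, b, c] (evenLastDiff P) =
      1 / 2 * (eval ![a, c - b, c] P - eval ![a, c - b, b] P +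
        (eval ![a, c - -b, c] P - eval ![a, c - -b, -b] P)) -
      eval ![a, c, c] P + eval ![a, b, b] P := by
  simp only [evenLastDiff, map_add, map_sub, smul_eval, eval_scale_one, eval_lastDiff,
    eval_subst3, eval_X, Matrix.cons_val, neg_one_mul]

lemma eval_theta (P : MvPolynomial (Fin 3) ℚ) (a b c : ℚ) :
    eval ![a, b, c] (theta P) = eval ![a, b, c] P + eval ![b - a, a, c] P
      - eval ![b - a, b, c] P + eval ![c - b, a, b] P - eval ![c - b, a, c] P := by
  simp [theta, eval_subst3]

lemma eval_thetaTwo (P : MvPolynomial (Fin 3) ℚ) (a b c : ℚ) :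
    eval ![a, b, c] (thetaTwo P) = eval ![a, b, c] P + eval ![a, c - b, b] P
      - eval ![a, c - b, c] P := by
  simp [thetaTwo, eval_subst3]

/-- `lastDiff P` is invariant under (x₂, x₃) ↦ (-x₂, -x₃), so its even part in x₂ is also even in
x₃. On x₂ = 0 and x₃ = 0 this part equals P(x₁, x₃, x₃) and -P(x₁, x₂, x₂), which the two correction
terms cancel. -/
lemma evenLastDiff_mem_V {N : ℕ} {P : MvPolynomial (Fin 3) ℚ} (hP : P ∈ V N 3) :
    evenLastDiff P ∈ V N 3 := by
  have hh := isHomogeneous_of_mem_V hP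
  have hX : ∀ i : Fin 3, (X i : MvPolynomial (Fin 3) ℚ).IsHomogeneous 1 := isHomogeneous_X ℚ
  have hd : (lastDiff P).IsHomogeneous (N - 3) :=
    (isHomogeneous_subst3 hh (hX 0) ((hX 2).sub (hX 1)) (hX 2)).sub
      (isHomogeneous_subst3 hh (hX 0) ((hX 2).sub (hX 1)) (hX 1))
  have hs : (scale 1 (-1) (lastDiff P)).IsHomogeneous (N - 3) := by
    intro d h
    rw [coeff_scale] at h
    exact hd (right_ne_zero_of_mul h)
  refine mem_V_of_isEvenVanishing (IsHomogeneous.add (IsHomogeneous.sub ?_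
    (isHomogeneous_subst3 hh (hX 0) (hX 2) (hX 2)))
    (isHomogeneous_subst3 hh (hX 0) (hX 1) (hX 1))) ?_
  · rw [smul_eq_C_mul, ← zero_add (N - 3)]
    exact (isHomogeneous_C _ _).mul (hd.add hs)
  have hp := isEvenVanishing_of_mem_V hP
  simp only [eval_evenLastDiff]
  constructor
  · intro a b c; simp only [hp.neg_fst]
  · intro a b c
    have h1 := hp.neg_trd a (c - b) b
    have h2 := hp.neg_trd a (c - -b) b
    have h3 := (hp.neg_snd a b (-b)).trans (hp.neg_trd a b b)
    simp only [neg_neg] at h1 h2 h3 ⊢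
    linear_combination h3
  · intro a b c
    have h1 := (hp.neg_snd a (c - -b) (-c)).trans (hp.neg_trd a _ c)
    have h2 := (hp.neg_snd a (c - b) (-c)).trans (hp.neg_trd a _ c)
    have h3 := (hp.neg_snd a c (-c)).trans (hp.neg_trd a _ c)
    have h4 := hp.neg_snd a (c - -b) b
    have h5 := hp.neg_snd a (c - b) b
    have h6 := hp.neg_trd a (c - -b) b
    have h7 := hp.neg_trd a (c - b) b
    have h8 := hp.neg_snd a (c - b) (-b)
    have e1 : -(c - -b) = -c - b := by ring
    have e2 : -(c - b) = -c - -b := by ring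
    simp only [e1, e2] at h1 h2 h3 h4 h5 h6 h7 h8
    linear_combination 1 / 2 * (h1 + h2 - h4 - h8 - h7 + h6) - h3
  · intro b c
    have h := hp.zero_fst
    simp only [h]
    norm_num
  · intro a c
    have h1 := hp.zero_snd a 0
    have h2 := hp.zero_trd a c
    simp only [neg_zero, sub_zero] at h1 h2 ⊢
    linear_combination h1 - h2
  · intro a b
    have h1 := hp.zero_trd a
    have h2 := hp.neg_snd a b b
    have h3 := hp.neg_trd a b b
    simp only [zero_sub, neg_neg] at h1 h2 h3 ⊢
    rw [h1, h1, h1]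
    linear_combination -1 / 2 * (h2 + h3)

lemma coeffVec_evenLastDiff (N : ℕ) (P : MvPolynomial (Fin 3) ℚ) :
    coeffVec N (evenLastDiff P) = coeffVec N (lastDiff P) := by
  have h1 : coeffVec N (subst3 (X 0) (X 2) (X 2) P) = 0 :=
    coeffVec_eq_zero_of_scale_zero N 1 (funext_vec fun a b c => by
      simp [eval_scale_one, eval_subst3])
  have h2 : coeffVec N (subst3 (X 0) (X 1) (X 1) P) = 0 :=
    coeffVec_eq_zero_of_scale_zero N 2 (funext_vec fun a b c => by
      simp [eval_scale_two, eval_subst3])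
  rw [evenLastDiff, map_add, map_sub, map_smul, map_add, coeffVec_scale_neg_one, h1, h2,
    sub_zero, add_zero, ← two_smul ℚ, smul_smul]
  norm_num

/-- As P is even in x₁, the right side of the relation defining W changes sign when x₁ and x₂ are
exchanged. -/
lemma eval_swap_of_mem_W {N : ℕ} {P : MvPolynomial (Fin 3) ℚ} {hr : 2 ≤ 3}
    (hP : P ∈ W N 3 hr) (a b c : ℚ) : eval ![b, a, c] P = -eval ![a, b, c] P := by
  obtain ⟨hV, hw⟩ := (mem_W_iff hr).1 hP
  have hp := (isEvenVanishing_of_mem_V hV).neg_fst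
  have h1 := hp (b - a) a c
  have h2 := hp (b - a) b c
  simp only [neg_sub] at h1 h2
  rw [hw a b c, hw b a c, h1, h2]
  ring

/-- The first three terms of `theta P` cancel by the relation; antisymmetry turns the other two into
`lastDiff P`. -/
lemma theta_of_mem_W {N : ℕ} {P : MvPolynomial (Fin 3) ℚ} {hr : 2 ≤ 3}
    (hP : P ∈ W N 3 hr) : theta P = lastDiff P := by
  refine funext_vec fun a b c => ?_
  rw [eval_theta, eval_lastDiff]
  linear_combination ((mem_W_iff hr).1 hP).2 a b c + eval_swap_of_mem_W hP a (c - b) b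
    - eval_swap_of_mem_W hP a (c - b) c

lemma thetaTwo_eq_sub (P : MvPolynomial (Fin 3) ℚ) : thetaTwo P = P - lastDiff P := by
  refine funext_vec fun a b c => ?_
  rw [eval_thetaTwo, map_sub, eval_lastDiff]
  ring

/-- `theta` changes `evenLastDiff P` only by terms invisible to `coeffVec`: one odd in x₂, one free
of x₃ (`D₂`) and one free of x₁ (`D₀`). -/
lemma coeffVec_theta_evenLastDiff {N : ℕ} {P : MvPolynomial (Fin 3) ℚ} {hr : 2 ≤ 3}
    (hP : P ∈ W N 3 hr) :
    coeffVec N (theta (evenLastDiff P)) = coeffVec N (evenLastDiff P) := by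
  obtain ⟨hV, hw⟩ := (mem_W_iff hr).1 hP
  have hs := eval_swap_of_mem_W hP
  have hp := isEvenVanishing_of_mem_V hV
  set U : MvPolynomial (Fin 3) ℚ := (1 / 2 : ℚ) •
    (subst3 (X 2 - X 1) (X 2 + X 0) (X 0) P - subst3 (X 2 - X 1) (X 2 + X 0) (X 2) P
      + subst3 (X 2 - X 1) (X 1 + X 0) (X 1) P - subst3 (X 2 - X 1) (X 1 + X 0) (X 0) P) with hU
  set D₂ := subst3 (X 1 - X 0) (X 0) (X 0) P - subst3 (X 1 - X 0) (X 1) (X 1) P with hD₂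
  set D₀ := subst3 (X 2 - X 1) (X 2) (X 2) P - subst3 (X 2 - X 1) (X 1) (X 1) P with hD₀
  have key : theta (evenLastDiff P) =
      evenLastDiff P + (U - scale 1 (-1) U) + D₂ + D₀ := by
    refine funext_vec fun a b c => ?_
    simp only [eval_theta, eval_evenLastDiff, hU, hD₂, hD₀, map_add, map_sub, smul_eval,
      eval_subst3, eval_scale_one, eval_X, Matrix.cons_val, neg_one_mul, hp.neg_trd,
      sub_neg_eq_add]
    -- The defining relation at pairs whose differences are c - b and c + a; with evenness and
    -- antisymmetry it accounts for all remaining terms.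
    have h1 : ∀ z, eval ![b - a, c - a, z] P =
        eval ![c - b, c - a, z] P - eval ![c - b, b - a, z] P := fun z => by
      have := hw (b - a) (c - a) z
      rwa [sub_sub_sub_cancel_right] at this
    have h2 : ∀ z, eval ![b - a, c + b, z] P =
        eval ![c + a, c + b, z] P - eval ![c + a, b - a, z] P := fun z => by
      have := hw (b - a) (c + b) z
      rwa [show c + b - (b - a) = c + a by ring] at this
    have h3 : ∀ z, eval ![c + b, -b + a, z] P = eval ![c + b, b - a, z] P := fun z => by
      have := hp.neg_snd (c + b) (b - a) z
      rwa [show -(b - a) = -b + a by ring] at this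
    rw [h1, h1, h2, h2, h3, h3]
    linarith [hs (b - a) (c - b) a, hs (b - a) (c - b) b, hs (b - a) (c - b) c,
      hs (c + a) (c + b) a, hs (c + a) (c + b) b, hs (c + a) (c + b) c,
      hs (c + a) (b - a) a, hs (c + a) (b - a) b, hs (c + a) (b - a) c,
      hs (c + b) (b - a) a, hs (c + b) (b - a) b, hs (c + b) (b - a) c, h2 a, h2 b, h2 c]
  have h2 : coeffVec N D₂ = 0 := coeffVec_eq_zero_of_scale_zero N 2 (funext_vec fun a b c => by
    simp [hD₂, eval_scale_two, eval_subst3])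
  have h0 : coeffVec N D₀ = 0 := coeffVec_eq_zero_of_scale_zero N 0 (funext_vec fun a b c => by
    simp [hD₀, eval_scale_zero, eval_subst3])
  rw [key, map_add, map_add, map_add, map_sub, coeffVec_scale_neg_one, h2, h0]
  simp

lemma coeffVec_vecMul_F {N : ℕ} {P : MvPolynomial (Fin 3) ℚ} {hr : 2 ≤ 3}
    (hP : P ∈ W N 3 hr) :
    Matrix.vecMul (coeffVec N P) (F N 3) = coeffVec N (evenLastDiff P - P) := by
  rw [F, Matrix.vecMul_sub, Matrix.vecMul_one, coeffVec_vecMul_E ((mem_W_iff hr).1 hP).1,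
    theta_of_mem_W hP, map_sub, coeffVec_evenLastDiff]

lemma coeffVec_vecMul_Ej_two_eq_neg {N : ℕ} {P : MvPolynomial (Fin 3) ℚ} {hr : 2 ≤ 3}
    (hP : P ∈ W N 3 hr) :
    Matrix.vecMul (coeffVec N P) (Ej N 3 2 (by norm_num)) =
      -Matrix.vecMul (coeffVec N P) (F N 3) := by
  rw [coeffVec_vecMul_Ej_two ((mem_W_iff hr).1 hP).1, thetaTwo_eq_sub, coeffVec_vecMul_F hP,
    map_sub, map_sub, coeffVec_evenLastDiff, neg_sub]

/-- The image of Tasaka's map lies in the left kernel of `E_{N,3}`. -/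
lemma coeffVec_vecMul_F_vecMul_E {N : ℕ} {P : MvPolynomial (Fin 3) ℚ} {hr : 2 ≤ 3}
    (hP : P ∈ W N 3 hr) :
    Matrix.vecMul (Matrix.vecMul (coeffVec N P) (F N 3)) (E N 3) = 0 := by
  have hV := ((mem_W_iff hr).1 hP).1
  -- With Q = `evenLastDiff P`: both π(P) E and π(Q) E equal π(Q), so E kills π(Q - P) = π(P) F.
  rw [coeffVec_vecMul_F hP, coeffVec_vecMul_E (Submodule.sub_mem _ (evenLastDiff_mem_V hV) hV),
    map_sub, theta_of_mem_W hP, map_sub, coeffVec_theta_evenLastDiff hP, coeffVec_evenLastDiff,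
    sub_self]

/-! ### The second copy of W and the dimension count -/

/-- The substitution `P ↦ P(x₂, x₃, x₁)`. -/
def cyc : MvPolynomial (Fin 3) ℚ →ₐ[ℚ] MvPolynomial (Fin 3) ℚ :=
  subst3 (X 1) (X 2) (X 0)

lemma eval_cyc (P : MvPolynomial (Fin 3) ℚ) (a b c : ℚ) :
    eval ![a, b, c] (cyc P) = eval ![b, c, a] P := by
  simp [cyc, eval_subst3]

lemma cyc_injective : Function.Injective cyc := by
  refine (injective_iff_map_eq_zero cyc).2 fun P h => funext_vec fun a b c => ?_
  rw [← eval_cyc, h, map_zero, map_zero]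

lemma cyc_mem_V {N : ℕ} {P : MvPolynomial (Fin 3) ℚ} (hP : P ∈ V N 3) : cyc P ∈ V N 3 := by
  have hp := isEvenVanishing_of_mem_V hP
  refine mem_V_of_isEvenVanishing (isHomogeneous_subst3 (isHomogeneous_of_mem_V hP)
    (isHomogeneous_X _ _) (isHomogeneous_X _ _) (isHomogeneous_X _ _)) ?_
  simp only [eval_cyc]
  exact ⟨fun a b c => hp.neg_trd b c a, fun a b c => hp.neg_fst b c a,
    fun a b c => hp.neg_snd b c a, fun b c => hp.zero_trd b c, fun a c => hp.zero_fst c a,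
    fun a b => hp.zero_snd b a⟩

/-- `thetaTwo (cyc P) = 0` is the relation defining W evaluated at (x₂, x₃, x₁). -/
lemma coeffVec_cyc_vecMul_Ej_two {N : ℕ} {P : MvPolynomial (Fin 3) ℚ} {hr : 2 ≤ 3}
    (hP : P ∈ W N 3 hr) :
    Matrix.vecMul (coeffVec N (cyc P)) (Ej N 3 2 (by norm_num)) = 0 := by
  obtain ⟨hV, hw⟩ := (mem_W_iff hr).1 hP
  have h : thetaTwo (cyc P) = 0 := by
    refine funext_vec fun a b c => ?_
    simp only [eval_thetaTwo, eval_cyc, map_zero]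
    linear_combination hw b c a
  rw [coeffVec_vecMul_Ej_two (cyc_mem_V hV), h, map_zero]

lemma C_three (N : ℕ) : C N 3 = Ej N 3 2 (by norm_num) * E N 3 := by
  simp [C]

lemma finrank_ker_mulVecLin {n : Type*} [Fintype n] [DecidableEq n] (A : Matrix n n ℚ) :
    Module.finrank ℚ (LinearMap.ker A.mulVecLin) =
      Module.finrank ℚ (LinearMap.ker A.vecMulLinear) := by
  have h1 := LinearMap.finrank_range_add_finrank_ker A.mulVecLin
  have h2 := LinearMap.finrank_range_add_finrank_ker A.transpose.mulVecLin
  have h3 := A.rank_transpose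
  rw [Matrix.mulVecLin_transpose] at h2
  rw [Matrix.rank, Matrix.rank, Matrix.mulVecLin_transpose] at h3
  omega

instance finite_W (N : ℕ) (hr : 2 ≤ 3) : Module.Finite ℚ (W N 3 hr) := by
  refine Module.Finite.of_injective ((coeffVec N).comp (W N 3 hr).subtype) ?_
  refine (injective_iff_map_eq_zero _).2 fun P h => Subtype.ext ?_
  exact eq_zero_of_coeffVec_eq_zero ((mem_W_iff hr).1 P.2).1 h

/-- If Tasaka's map is injective in depth three, two independent copies of `W_{N,3}` embed into
the left kernel of `C_{N,3}`. -/
lemma two_mul_finrank_W_le {N : ℕ} {hr : 2 ≤ 3} (hinj : Function.Injective (tasakaMap N 3 hr)) :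
    2 * Module.finrank ℚ (W N 3 hr) ≤ Module.finrank ℚ (LinearMap.ker (C N 3).mulVecLin) := by
  have hF : ∀ P ∈ W N 3 hr, Matrix.vecMul (coeffVec N P) (F N 3) = 0 → P = 0 := by
    intro P hP h
    have : tasakaMap N 3 hr ⟨P, hP⟩ = tasakaMap N 3 hr 0 := by rw [map_zero]; exact h
    exact congrArg Subtype.val (hinj this)
  let f : (W N 3 hr × W N 3 hr) →ₗ[ℚ] Vect N 3 :=
    (coeffVec N ∘ₗ (W N 3 hr).subtype).coprod
      (coeffVec N ∘ₗ cyc.toLinearMap ∘ₗ (W N 3 hr).subtype)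
  have hf : ∀ P, f P = coeffVec N P.1 + coeffVec N (cyc P.2) := fun P => rfl
  have hmul : ∀ P, Matrix.vecMul (f P) (Ej N 3 2 (by norm_num)) =
      -Matrix.vecMul (coeffVec N P.1) (F N 3) := fun P => by
    rw [hf, Matrix.add_vecMul, coeffVec_cyc_vecMul_Ej_two P.2.2, add_zero,
      coeffVec_vecMul_Ej_two_eq_neg P.1.2]
  have hker : ∀ P, f P ∈ LinearMap.ker (C N 3).vecMulLinear := fun P => by
    rw [LinearMap.mem_ker, Matrix.vecMulLinear_apply, C_three, ← Matrix.vecMul_vecMul, hmul,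
      Matrix.neg_vecMul, coeffVec_vecMul_F_vecMul_E P.1.2, neg_zero]
  have hfinj : Function.Injective (f.codRestrict _ hker) := by
    refine (injective_iff_map_eq_zero _).2 fun P h => ?_
    have h0 : f P = 0 := congrArg Subtype.val h
    -- E^(2) isolates the first component, where Tasaka's map is injective; the second is then
    -- recovered from `cyc`.
    have h1 : (P.1 : MvPolynomial (Fin 3) ℚ) = 0 := by
      refine hF _ P.1.2 ?_
      have := hmul P
      rwa [h0, Matrix.zero_vecMul, zero_eq_neg] at this
    have h2 : (P.2 : MvPolynomial (Fin 3) ℚ) = 0 := by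
      rw [hf, h1, map_zero, zero_add] at h0
      exact cyc_injective ((eq_zero_of_coeffVec_eq_zero
        (cyc_mem_V ((mem_W_iff hr).1 P.2.2).1) h0).trans (map_zero cyc).symm)
    exact Prod.ext (Subtype.ext h1) (Subtype.ext h2)
  have := LinearMap.finrank_le_finrank_of_injective hfinj
  rwa [Module.finrank_prod, ← two_mul, ← finrank_ker_mulVecLin] at this

/-! ### Antisymmetric binary forms and their rotation sums -/

/-- The antisymmetric binary form `∑ cᵢ (x^{2i+2} y^{2n-2i-2} - x^{2n-2i-2} y^{2i+2})`, evaluated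
in a commutative `ℚ`-algebra. -/
def altForm {R : Type*} [CommRing R] [Algebra ℚ R] (n : ℕ) (c : Fin ((n - 1) / 2) → ℚ) (x y : R) :
    R :=
  ∑ i : Fin ((n - 1) / 2), c i • (x ^ (2 * (i : ℕ) + 2) * y ^ (2 * (n - i - 1)) -
    x ^ (2 * (n - i - 1)) * y ^ (2 * (i : ℕ) + 2))

/-- The sum of `altForm` over the rotations of order three. -/
def rotSum {R : Type*} [CommRing R] [Algebra ℚ R] (n : ℕ) (c : Fin ((n - 1) / 2) → ℚ) (x y : R) :
    R :=
  altForm n c x y + altForm n c y (x - y) + altForm n c (x - y) x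

section Symmetry

variable {R : Type*} [CommRing R] [Algebra ℚ R] (n : ℕ) (c : Fin ((n - 1) / 2) → ℚ) (x y : R)

lemma altForm_swap : altForm n c y x = -altForm n c x y := by
  rw [altForm, altForm, ← Finset.sum_neg_distrib]
  refine Finset.sum_congr rfl fun i _ => ?_
  rw [← smul_neg]
  congr 1
  ring

lemma altForm_neg_left : altForm n c (-x) y = altForm n c x y := by
  refine Finset.sum_congr rfl fun i _ => ?_
  rw [Even.neg_pow ⟨i + 1, by ring⟩, Even.neg_pow ⟨n - i - 1, by ring⟩]

lemma altForm_neg_right : altForm n c x (-y) = altForm n c x y := by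
  rw [altForm_swap, altForm_neg_left, ← altForm_swap]

lemma altForm_zero_left : altForm n c 0 y = 0 := by
  refine Finset.sum_eq_zero fun i _ => ?_
  have := i.2
  rw [zero_pow (by omega), zero_pow (by omega), zero_mul, zero_mul, sub_zero, smul_zero]

lemma altForm_mul (t : R) : altForm n c (t * x) (t * y) = t ^ (2 * n) * altForm n c x y := by
  rw [altForm, altForm, Finset.mul_sum]
  refine Finset.sum_congr rfl fun i _ => ?_
  have h : t ^ (2 * n) = t ^ (2 * (i : ℕ) + 2) * t ^ (2 * (n - i - 1)) := by
    rw [← pow_add]; congr 1; have := i.2; omega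
  rw [h, mul_smul_comm, mul_pow, mul_pow, mul_pow, mul_pow]
  congr 1
  ring

/-- In the ratio t = y/x, this lemma and the next are the anti-invariance under t ↦ t⁻¹ and t ↦ 1 -
t, the generators of the anharmonic group. -/
lemma rotSum_swap : rotSum n c y x = -rotSum n c x y := by
  have h1 := altForm_neg_right n c x (y - x)
  have h2 := altForm_neg_left n c (y - x) y
  rw [neg_sub] at h1 h2
  rw [rotSum, rotSum, ← h1, ← h2, altForm_swap n c x y, altForm_swap n c (x - y) x,
    altForm_swap n c y (x - y)]
  ring

lemma rotSum_sub : rotSum n c x (x - y) = -rotSum n c x y := by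
  rw [rotSum, rotSum, sub_sub_cancel, altForm_swap n c (x - y) x, altForm_swap n c y (x - y),
    altForm_swap n c x y]
  ring

lemma rotSum_mul (t : R) : rotSum n c (t * x) (t * y) = t ^ (2 * n) * rotSum n c x y := by
  rw [rotSum, rotSum, ← mul_sub, altForm_mul, altForm_mul, altForm_mul]
  ring

lemma map_altForm {A : Type*} [CommRing A] [Algebra ℚ A] (f : R →ₐ[ℚ] A) :
    f (altForm n c x y) = altForm n c (f x) (f y) := by
  simp [altForm]

lemma map_rotSum {A : Type*} [CommRing A] [Algebra ℚ A] (f : R →ₐ[ℚ] A) :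
    f (rotSum n c x y) = rotSum n c (f x) (f y) := by
  simp [rotSum, map_altForm]

end Symmetry

lemma rotSum_one_sub {n : ℕ} {c : Fin ((n - 1) / 2) → ℚ} {t : ℚ} (h : rotSum n c 1 t = 0) :
    rotSum n c 1 (1 - t) = 0 := by
  rw [rotSum_sub, h, neg_zero]

lemma rotSum_one_inv {n : ℕ} {c : Fin ((n - 1) / 2) → ℚ} {t : ℚ} (ht : t ≠ 0)
    (h : rotSum n c 1 t = 0) : rotSum n c 1 t⁻¹ = 0 := by
  have h1 := rotSum_mul n c 1 t⁻¹ t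
  rw [mul_one, mul_inv_cancel₀ ht, rotSum_swap, h, neg_zero] at h1
  exact (mul_eq_zero.1 h1.symm).resolve_left (pow_ne_zero _ ht)

lemma natDegree_altForm_le {n : ℕ} (c : Fin ((n - 1) / 2) → ℚ) {x y : Polynomial ℚ}
    (hx : x.natDegree ≤ 1) (hy : y.natDegree ≤ 1) : (altForm n c x y).natDegree ≤ 2 * n := by
  have hp : ∀ a b, (x ^ a * y ^ b).natDegree ≤ a + b := fun a b =>
    (Polynomial.natDegree_mul_le_of_le (Polynomial.natDegree_pow_le_of_le a hx)
      (Polynomial.natDegree_pow_le_of_le b hy)).trans (by omega)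
  refine Polynomial.natDegree_sum_le_of_forall_le _ _ fun i _ => ?_
  have := i.2
  refine (Polynomial.natDegree_smul_le _ _).trans ((Polynomial.natDegree_sub_le _ _).trans
    (max_le ((hp _ _).trans ?_) ((hp _ _).trans ?_))) <;> omega

/-! ### Zeros forced by the anharmonic group -/

/-- The orbit of `s` under the anharmonic group generated by `t ↦ 1 - t` and `t ↦ t⁻¹`, in
increasing order if `2 < s`. -/
def anharmonic (s : ℚ) : Fin 6 → ℚ :=
  ![1 - s, (1 - s)⁻¹, s⁻¹, 1 - s⁻¹, (1 - s⁻¹)⁻¹, s]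

/-- The points with nontrivial stabilizer in the anharmonic group; the first five entries separate
the entries of `anharmonic s` if `2 < s`. -/
def anharmonicFixed : Fin 6 → ℚ := ![-1, 0, 1 / 2, 1, 2, 2]

lemma anharmonic_separated {s : ℚ} (hs : 2 < s) {k l : Fin 6} (h : k < l) :
    anharmonic s k < anharmonicFixed k ∧ anharmonicFixed k < anharmonic s l := by
  have h0 : 0 < s := by linarith
  have a1 : 0 < s⁻¹ := inv_pos.2 h0
  have a2 : s⁻¹ < 1 / 2 := by rw [one_div]; exact inv_strictAnti₀ (by norm_num) hs
  have b : (1 - s)⁻¹ = -(s - 1)⁻¹ := by rw [← inv_neg, neg_sub]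
  have b1 : 0 < (s - 1)⁻¹ := inv_pos.2 (by linarith)
  have b2 : (s - 1)⁻¹ < 1 := inv_lt_one_of_one_lt₀ (by linarith)
  have c1 : 1 < (1 - s⁻¹)⁻¹ := (one_lt_inv₀ (by linarith)).2 (by linarith)
  have c2 : (1 - s⁻¹)⁻¹ < 2 := by
    rw [inv_lt_comm₀ (by linarith) (by norm_num)]; linarith
  fin_cases k <;> fin_cases l <;>
    first
    | exact absurd h (by decide)
    | (simp only [anharmonic, anharmonicFixed, Fin.zero_eta, Fin.mk_one, Fin.reduceFinMk,
        Matrix.cons_val]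
       constructor <;> linarith)

lemma anharmonicFixed_lt {k l : Fin 6} (h : k < l) (hl : l ≠ 5) :
    anharmonicFixed k < anharmonicFixed l := by
  fin_cases k <;> fin_cases l <;>
    first
    | exact absurd h (by decide)
    | exact absurd rfl hl
    | norm_num [anharmonicFixed]

lemma anharmonic_injOn {s t : ℚ} (k : Fin 6) (h : anharmonic s k = anharmonic t k) : s = t := by
  fin_cases k <;>
  simpa [anharmonic] using h

/-- The zeros forced on a rotation sum that vanishes at `(1, j + 3)` for all `j < f`. -/
def forcedZero (f : ℕ) : Fin 6 × Option (Fin f) → ℚ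
  | (k, none) => anharmonicFixed k
  | (k, some j) => anharmonic ((j : ℕ) + 3) k

lemma forcedZero_lt {f : ℕ} {k l : Fin 6} (h : k < l) (o o' : Option (Fin f))
    (hl : (l, o') ≠ (5, none)) : forcedZero f (k, o) < forcedZero f (l, o') := by
  have hs : ∀ j : Fin f, (2 : ℚ) < (j : ℕ) + 3 := fun j => by
    have : (0 : ℚ) ≤ (j : ℕ) := Nat.cast_nonneg _
    linarith
  have h1 : forcedZero f (k, o) ≤ anharmonicFixed k := by
    cases o with
    | none => exact le_rfl
    | some j => exact (anharmonic_separated (hs j) h).1.le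
  refine h1.trans_lt ?_
  cases o' with
  | none => exact anharmonicFixed_lt h fun hl' => hl (by rw [hl'])
  | some j => exact (anharmonic_separated (hs j) h).2

lemma forcedZero_injOn (f : ℕ) : Set.InjOn (forcedZero f) {x | x ≠ (5, none)} := by
  rintro ⟨k, o⟩ hk ⟨l, o'⟩ hl h
  rcases lt_trichotomy k l with hkl | rfl | hkl
  · exact absurd h (forcedZero_lt hkl o o' hl).ne
  · have hne : ∀ j : Fin f, (k, (none : Option (Fin f))) ≠ (5, none) →
        anharmonicFixed k ≠ anharmonic ((j : ℕ) + 3) k := by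
      intro j hk
      have hk5 : k < 5 := lt_of_le_of_ne (Fin.le_last k) fun h => hk (by rw [h])
      refine (anharmonic_separated ?_ hk5).1.ne'
      have : (0 : ℚ) ≤ (j : ℕ) := Nat.cast_nonneg _
      linarith
    cases o with
    | none =>
      cases o' with
      | none => rfl
      | some j => exact absurd h (hne j hk)
    | some i =>
      cases o' with
      | none => exact absurd h.symm (hne i hl)
      | some j =>
        have := anharmonic_injOn k h
        have hij : i = j := Fin.ext (by exact_mod_cast add_right_cancel this)
        rw [hij]
  · exact absurd h (forcedZero_lt hkl o' o hk).ne'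

lemma rotSum_anharmonic {n : ℕ} {c : Fin ((n - 1) / 2) → ℚ} {s : ℚ} (hs : 2 < s)
    (h : rotSum n c 1 s = 0) (k : Fin 6) : rotSum n c 1 (anharmonic s k) = 0 := by
  have h1 := rotSum_one_sub h
  have h2 := rotSum_one_inv (by linarith) h
  have h3 := rotSum_one_sub h2
  have h4 := rotSum_one_inv (by linarith) h1
  have h5 := rotSum_one_inv (by
    have : s⁻¹ < 1 := inv_lt_one_of_one_lt₀ (by linarith)
    linarith) h3
  fin_cases k
  exacts [h1, h4, h2, h3, h5, h]

/-- At 1/2, fixed by t ↦ 1 - t, the sum equals its own negative; 2 and -1 are images of 1/2. At 0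
the terms cancel directly, and 1 is the image of 0. -/
lemma rotSum_anharmonicFixed {n : ℕ} (c : Fin ((n - 1) / 2) → ℚ) (k : Fin 6) :
    rotSum n c 1 (anharmonicFixed k) = 0 := by
  have h0 : rotSum n c 1 (0 : ℚ) = 0 := by
    have h1 : altForm n c (1 : ℚ) 1 = 0 := by
      have := altForm_swap n c (1 : ℚ) 1
      linarith
    rw [rotSum, altForm_swap n c 0 1, altForm_zero_left, sub_zero, altForm_zero_left, h1]
    simp
  have h1 : rotSum n c 1 (1 : ℚ) = 0 := by simpa using rotSum_one_sub h0
  have h2 : rotSum n c 1 (1 / 2 : ℚ) = 0 := by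
    have := rotSum_sub n c 1 (1 / 2 : ℚ)
    rw [show (1 : ℚ) - 1 / 2 = 1 / 2 by norm_num] at this
    linarith
  have h3 : rotSum n c 1 (2 : ℚ) = 0 := by
    simpa using rotSum_one_inv (by norm_num) h2
  have h4 : rotSum n c 1 (-1 : ℚ) = 0 := by
    have := rotSum_one_sub h3
    rwa [show (1 : ℚ) - 2 = -1 by norm_num] at this
  fin_cases k
  exacts [h4, h0, h2, h1, h3, h3]

/-- Each prescribed zero j + 3 brings its whole orbit of six. With the five forced zeros this gives
6(n/3) + 5 ≥ 2n + 1 roots, more than the degree allows. -/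
lemma rotSum_one_X_eq_zero {n : ℕ} {c : Fin ((n - 1) / 2) → ℚ}
    (h : ∀ j : Fin (n / 3), rotSum n c 1 ((j : ℕ) + 3 : ℚ) = 0) :
    rotSum n c 1 (Polynomial.X : Polynomial ℚ) = 0 := by
  have heval : ∀ t : ℚ, (rotSum n c 1 (Polynomial.X : Polynomial ℚ)).eval t = rotSum n c 1 t := by
    intro t
    have := map_rotSum n c 1 Polynomial.X (Polynomial.aeval t : Polynomial ℚ →ₐ[ℚ] ℚ)
    rwa [map_one, Polynomial.aeval_X, Polynomial.coe_aeval_eq_eval] at this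
  refine Polynomial.eq_zero_of_natDegree_lt_card_of_eval_eq_zero' _
    ((Finset.univ.erase ((5 : Fin 6), none)).image (forcedZero (n / 3))) ?_ ?_
  · intro t ht
    obtain ⟨⟨k, o⟩, -, rfl⟩ := Finset.mem_image.1 ht
    rw [heval]
    cases o with
    | none => exact rotSum_anharmonicFixed c k
    | some j =>
      refine rotSum_anharmonic ?_ (h j) k
      have : (0 : ℚ) ≤ (j : ℕ) := Nat.cast_nonneg _
      linarith
  · rw [Finset.card_image_of_injOn ((forcedZero_injOn _).mono fun x hx => by simpa using hx),
      Finset.card_erase_of_mem (Finset.mem_univ _), Finset.card_univ, Fintype.card_prod,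
      Fintype.card_option, Fintype.card_fin, Fintype.card_fin]
    have h1 : (1 : Polynomial ℚ).natDegree ≤ 1 := by simp
    have hX : (Polynomial.X : Polynomial ℚ).natDegree ≤ 1 := by simp
    have hs : (1 - Polynomial.X : Polynomial ℚ).natDegree ≤ 1 :=
      Polynomial.natDegree_sub_le_of_le h1 hX
    have : (rotSum n c 1 (Polynomial.X : Polynomial ℚ)).natDegree ≤ 2 * n :=
      Polynomial.natDegree_add_le_of_degree_le (Polynomial.natDegree_add_le_of_degree_le
        (natDegree_altForm_le c h1 hX) (natDegree_altForm_le c hX hs))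
        (natDegree_altForm_le c hs h1)
    omega

lemma rotSum_eq_zero {n : ℕ} {c : Fin ((n - 1) / 2) → ℚ}
    (h : ∀ j : Fin (n / 3), rotSum n c 1 ((j : ℕ) + 3 : ℚ) = 0) (a b : ℚ) :
    rotSum n c a b = 0 := by
  have h1 : ∀ t : ℚ, rotSum n c 1 t = 0 := fun t => by
    have := map_rotSum n c 1 Polynomial.X (Polynomial.aeval t : Polynomial ℚ →ₐ[ℚ] ℚ)
    rw [map_one, Polynomial.aeval_X, rotSum_one_X_eq_zero h, map_zero] at this
    exact this.symm
  have h2 : ∀ x y : ℚ, x ≠ 0 → rotSum n c x y = 0 := fun x y hx => by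
    have := rotSum_mul n c 1 (x⁻¹ * y) x
    rwa [mul_one, mul_inv_cancel_left₀ hx, h1, mul_zero] at this
  by_cases ha : a = 0
  · by_cases hb : b = 0
    · have := rotSum_swap n c (0 : ℚ) 0
      rw [ha, hb]
      linarith
    · rw [rotSum_swap, h2 b a hb, neg_zero]
  · exact h2 a b ha

/-! ### Even period polynomials and the dimension of W -/

/-- The coefficient vectors of the binary forms `altForm n c` whose rotation sum vanishes. -/
def periodCoeffs (n : ℕ) : Submodule ℚ (Fin ((n - 1) / 2) → ℚ) where
  carrier := {c | ∀ a b : ℚ, rotSum n c a b = 0}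
  zero_mem' a b := by simp [rotSum, altForm]
  add_mem' {c d} hc hd a b := by
    have h : ∀ x y : ℚ, altForm n (c + d) x y = altForm n c x y + altForm n d x y := fun x y => by
      simp [altForm, add_mul, Finset.sum_add_distrib]
    have := hc a b; have := hd a b
    simp only [rotSum, h] at *
    linarith
  smul_mem' t c hc a b := by
    have h : ∀ x y : ℚ, altForm n (t • c) x y = t * altForm n c x y := fun x y => by
      simp [altForm, mul_assoc, Finset.mul_sum]
    have := hc a b
    simp only [rotSum, h] at *
    linear_combination t * this

lemma le_finrank_periodCoeffs (n : ℕ) :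
    (n - 1) / 2 - n / 3 ≤ Module.finrank ℚ (periodCoeffs n) := by
  let f : (Fin ((n - 1) / 2) → ℚ) →ₗ[ℚ] (Fin (n / 3) → ℚ) :=
    { toFun := fun c j => rotSum n c 1 ((j : ℕ) + 3 : ℚ)
      map_add' := fun c d => by
        ext j
        simp [rotSum, altForm, add_mul, Finset.sum_add_distrib]
        ring
      map_smul' := fun t c => by
        ext j
        simp [rotSum, altForm, mul_assoc, Finset.mul_sum, mul_add] }
  have h1 := LinearMap.finrank_range_add_finrank_ker f
  have h2 := Submodule.finrank_le (LinearMap.range f)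
  have h3 : LinearMap.ker f ≤ periodCoeffs n := fun c hc a b =>
    rotSum_eq_zero (fun j => congrFun (LinearMap.mem_ker.1 hc) j) a b
  have h4 := Submodule.finrank_mono h3
  rw [Module.finrank_fin_fun] at h1 h2
  omega

/-- The ternary form `∑ₙ pₙ(x₁, x₂) x₃^{2(M-1-n)}` built from binary forms `pₙ` of degree `2n`. -/
def periodForm (M : ℕ) :
    ((n : Fin (M - 1)) → periodCoeffs n) →ₗ[ℚ] MvPolynomial (Fin 3) ℚ where
  toFun c := ∑ n : Fin (M - 1), altForm (n : ℕ) (c n).1 (X 0) (X 1) * X 2 ^ (2 * (M - 1 - n))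
  map_add' c d := by
    simp [altForm, add_smul, Finset.sum_add_distrib, add_mul]
  map_smul' t c := by
    simp [altForm, mul_smul, Finset.smul_sum, Finset.sum_mul]

lemma periodForm_apply (M : ℕ) (c : (n : Fin (M - 1)) → periodCoeffs n) :
    periodForm M c =
      ∑ n : Fin (M - 1), altForm (n : ℕ) (c n).1 (X 0) (X 1) * X 2 ^ (2 * (M - 1 - n)) := rfl

lemma eval_periodForm (M : ℕ) (c : (n : Fin (M - 1)) → periodCoeffs n) (x y z : ℚ) :
    eval ![x, y, z] (periodForm M c) =
      ∑ n : Fin (M - 1), altForm (n : ℕ) (c n).1 x y * z ^ (2 * (M - 1 - n)) := by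
  have h : ∀ n : Fin (M - 1), eval ![x, y, z] (altForm (n : ℕ) (c n).1 (X 0) (X 1)) =
      altForm (n : ℕ) (c n).1 x y := fun n => by
    simp [altForm, smul_eval]
  simp [periodForm_apply, h]

lemma isHomogeneous_altForm (n : ℕ) (c : Fin ((n - 1) / 2) → ℚ) :
    (altForm n c (X 0) (X 1) : MvPolynomial (Fin 3) ℚ).IsHomogeneous (2 * n) := by
  refine IsHomogeneous.sum _ _ _ fun i _ => ?_
  have hi := i.2
  rw [smul_eq_C_mul, ← zero_add (2 * n)]
  refine (isHomogeneous_C _ _).mul (IsHomogeneous.sub ?_ ?_)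
  · have h := (isHomogeneous_X_pow (R := ℚ) (0 : Fin 3) (2 * (i : ℕ) + 2)).mul
      (isHomogeneous_X_pow (R := ℚ) (1 : Fin 3) (2 * (n - i - 1)))
    rwa [show 2 * (i : ℕ) + 2 + 2 * (n - i - 1) = 2 * n by omega] at h
  · have h := (isHomogeneous_X_pow (R := ℚ) (0 : Fin 3) (2 * (n - i - 1))).mul
      (isHomogeneous_X_pow (R := ℚ) (1 : Fin 3) (2 * (i : ℕ) + 2))
    rwa [show 2 * (n - i - 1) + (2 * (i : ℕ) + 2) = 2 * n by omega] at h

lemma periodForm_mem_V (M : ℕ) (c : (n : Fin (M - 1)) → periodCoeffs n) :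
    periodForm M c ∈ V (2 * M + 1) 3 := by
  refine mem_V_of_isEvenVanishing ?_ ?_
  · refine IsHomogeneous.sum _ _ _ fun n _ => ?_
    have := n.2
    convert (isHomogeneous_altForm n (c n).1).mul
      (isHomogeneous_X_pow (R := ℚ) (2 : Fin 3) (2 * (M - 1 - n))) using 1
    omega
  · simp only [eval_periodForm]
    refine ⟨fun x y z => ?_, fun x y z => ?_, fun x y z => ?_, fun y z => ?_, fun x z => ?_,
      fun x y => ?_⟩
    · simp only [altForm_neg_left]
    · simp only [altForm_neg_right]
    · refine Finset.sum_congr rfl fun n _ => ?_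
      rw [(even_two_mul _).neg_pow]
    · simp only [altForm_zero_left, zero_mul, Finset.sum_const_zero]
    · refine Finset.sum_eq_zero fun n _ => ?_
      rw [altForm_swap, altForm_zero_left, neg_zero, zero_mul]
    · refine Finset.sum_eq_zero fun n _ => ?_
      have := n.2
      rw [zero_pow (by omega), mul_zero]

/-- x₃ is inert in the relation, which for even antisymmetric forms is the vanishing of the rotation
sum. -/
lemma periodForm_mem_W (M : ℕ) (hr : 2 ≤ 3) (c : (n : Fin (M - 1)) → periodCoeffs n) :
    periodForm M c ∈ W (2 * M + 1) 3 hr := by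
  refine (mem_W_iff hr).2 ⟨periodForm_mem_V M c, fun x y z => ?_⟩
  rw [eval_periodForm, eval_periodForm, eval_periodForm, ← Finset.sum_sub_distrib]
  refine Finset.sum_congr rfl fun n _ => ?_
  have h := (c n).2 x y
  have h1 := altForm_neg_left n (c n).1 (x - y) x
  have h2 := altForm_neg_left n (c n).1 (x - y) y
  have h3 := altForm_swap n (c n).1 (x - y) y
  rw [neg_sub] at h1 h2
  rw [rotSum] at h
  rw [h1, h2]
  linear_combination z ^ (2 * (M - 1 - (n : ℕ))) * (h - h3)

lemma coeff_X_pow_mul_X_pow_mul_X_pow (a b c a' b' c' : ℕ) :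
    coeff (expo ![a' + 1, b' + 1, c' + 1]) (X 0 ^ a * X 1 ^ b * X 2 ^ c : MvPolynomial (Fin 3) ℚ) =
      if a = a' ∧ b = b' ∧ c = c' then 1 else 0 := by
  have h : (X 0 ^ a * X 1 ^ b * X 2 ^ c : MvPolynomial (Fin 3) ℚ) =
      monomial (expo ![a + 1, b + 1, c + 1]) 1 :=
    MvPolynomial.funext fun x => by simp [eval_monomial_expo, Fin.prod_univ_three]
  rw [h, coeff_monomial]
  congr 1
  refine propext ⟨fun h => ?_, fun ⟨h1, h2, h3⟩ => by rw [h1, h2, h3]⟩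
  have := DFunLike.congr_fun h
  exact ⟨by simpa using this 0, by simpa using this 1, by simpa using this 2⟩

/-- The power of x₃ determines n. Since i < (n - 1)/2, the x₁-exponent is below n in the first
monomial of each pair and above n in the second, so no two monomials collide. -/
lemma coeff_periodForm (M : ℕ) (c : (n : Fin (M - 1)) → periodCoeffs n) (n : Fin (M - 1))
    (i : Fin (((n : ℕ) - 1) / 2)) :
    coeff (expo ![2 * (i : ℕ) + 2 + 1, 2 * (n - i - 1) + 1, 2 * (M - 1 - n) + 1])
      (periodForm M c) = (c n).1 i := by
  have hn := n.2
  have hi := i.2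
  have hterm : ∀ (n' : Fin (M - 1)) (i' : Fin (((n' : ℕ) - 1) / 2)),
      coeff (expo ![2 * (i : ℕ) + 2 + 1, 2 * (n - i - 1) + 1, 2 * (M - 1 - n) + 1])
        (((c n').1 i' • (X 0 ^ (2 * (i' : ℕ) + 2) * X 1 ^ (2 * ((n' : ℕ) - i' - 1)) -
          X 0 ^ (2 * ((n' : ℕ) - i' - 1)) * X 1 ^ (2 * (i' : ℕ) + 2)) * X 2 ^ (2 * (M - 1 - n')) :
            MvPolynomial (Fin 3) ℚ)) =
      if (n' : ℕ) = n ∧ (i' : ℕ) = i then (c n').1 i' else 0 := by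
    intro n' i'
    have hn' := n'.2
    have hi' := i'.2
    rw [smul_mul_assoc, sub_mul, coeff_smul, coeff_sub, coeff_X_pow_mul_X_pow_mul_X_pow,
      coeff_X_pow_mul_X_pow_mul_X_pow, 
      if_neg (show ¬(2 * ((n' : ℕ) - i' - 1) = 2 * (i : ℕ) + 2 ∧
        2 * (i' : ℕ) + 2 = 2 * ((n : ℕ) - i - 1) ∧
        2 * (M - 1 - (n' : ℕ)) = 2 * (M - 1 - (n : ℕ))) by omega)]
    by_cases h : (n' : ℕ) = n ∧ (i' : ℕ) = i
    · rw [if_pos h, if_pos (by omega)]; simp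
    · rw [if_neg h, if_neg (by omega)]; simp
  rw [periodForm_apply, coeff_sum]
  simp only [altForm, Finset.sum_mul, coeff_sum, hterm]
  rw [Finset.sum_eq_single n, Finset.sum_eq_single i]
  · simp
  · intro i' _ h
    rw [if_neg fun h' => h (Fin.ext h'.2)]
  · simp
  · intro n' _ h
    refine Finset.sum_eq_zero fun i' _ => ?_
    rw [if_neg fun h' => h (Fin.ext h'.1)]
  · simp

lemma periodForm_injective (M : ℕ) : Function.Injective (periodForm M) := by
  intro c d h
  ext n i
  rw [← coeff_periodForm, ← coeff_periodForm, h]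

lemma sum_le_finrank_W (M : ℕ) (hr : 2 ≤ 3) :
    ∑ n ∈ Finset.range (M - 1), ((n - 1) / 2 - n / 3) ≤
      Module.finrank ℚ (W (2 * M + 1) 3 hr) := by
  have h := LinearMap.finrank_le_finrank_of_injective
    (f := (periodForm M).codRestrict _ (periodForm_mem_W M hr))
    fun c d hcd => periodForm_injective M (congrArg Subtype.val hcd)
  rw [Module.finrank_pi_fintype] at h
  rw [← Fin.sum_univ_eq_sum_range (fun n => (n - 1) / 2 - n / 3)]
  exact (Finset.sum_le_sum fun (n : Fin (M - 1)) _ => le_finrank_periodCoeffs n).trans h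

/-! ### Generating series -/

/-- The dimension of the space of cusp forms of weight `k`. -/
def cuspDim (k : ℕ) : ℕ :=
  if Even k then (k / 2 - 2) / 2 - (k / 2 - 1) / 3 else 0

lemma seriesS_eq : seriesS = PowerSeries.mk fun k => (cuspDim k : ℚ) := by
  have h : PowerSeries.constantCoeff
      ((1 - PowerSeries.X ^ 4) * (1 - PowerSeries.X ^ 6) : PowerSeries ℚ) ≠ 0 := by simp
  rw [seriesS, eq_comm, PowerSeries.eq_mul_inv_iff_mul_eq h]
  have hexp : (PowerSeries.mk fun k => (cuspDim k : ℚ)) *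
      ((1 - PowerSeries.X ^ 4) * (1 - PowerSeries.X ^ 6)) =
      (PowerSeries.mk fun k => (cuspDim k : ℚ)) -
        PowerSeries.X ^ 4 * (PowerSeries.mk fun k => (cuspDim k : ℚ)) -
        PowerSeries.X ^ 6 * (PowerSeries.mk fun k => (cuspDim k : ℚ)) +
        PowerSeries.X ^ 10 * (PowerSeries.mk fun k => (cuspDim k : ℚ)) := by ring
  rw [hexp]
  ext k
  simp only [map_add, map_sub, PowerSeries.coeff_X_pow_mul', PowerSeries.coeff_mk,
    PowerSeries.coeff_X_pow]
  have key : (cuspDim k + (if 10 ≤ k then cuspDim (k - 10) else 0) : ℕ) =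
      (if 4 ≤ k then cuspDim (k - 4) else 0) + (if 6 ≤ k then cuspDim (k - 6) else 0) +
        if k = 12 then 1 else 0 := by
    have he : ∀ m, cuspDim (2 * m) = (m - 2) / 2 - (m - 1) / 3 := fun m => by
      rw [cuspDim, if_pos (even_two_mul m), Nat.mul_div_cancel_left m (by norm_num)]
    have ho : ∀ m, cuspDim (2 * m + 1) = 0 := fun m =>
      if_neg (by rw [Nat.even_iff]; omega)
    by_cases hk : k ≤ 12
    -- Small weights are checked by hand, which covers the exceptional term at 12; beyond that all
    -- shifts are genuine subtractions.
    · interval_cases k <;> decide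
    · rw [if_pos (by omega), if_pos (by omega), if_pos (by omega), if_neg (by omega)]
      rcases Nat.even_or_odd' k with ⟨m, rfl | rfl⟩
      · rw [show 2 * m - 10 = 2 * (m - 5) by omega, show 2 * m - 4 = 2 * (m - 2) by omega,
          show 2 * m - 6 = 2 * (m - 3) by omega, he, he, he, he]
        omega
      · rw [show 2 * m + 1 - 10 = 2 * (m - 5) + 1 by omega,
          show 2 * m + 1 - 4 = 2 * (m - 2) + 1 by omega,
          show 2 * m + 1 - 6 = 2 * (m - 3) + 1 by omega, ho, ho, ho, ho]
  have key' := congrArg (Nat.cast : ℕ → ℚ) key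
  push_cast at key'
  linear_combination key'

/-- The coefficients of `O(x) S(x)`. -/
def tripleDim (k : ℕ) : ℕ :=
  if Even k then 0 else ∑ n ∈ Finset.range (k / 2 - 1), ((n - 1) / 2 - n / 3)

lemma seriesO_mul_seriesS : seriesO * seriesS = PowerSeries.mk fun k => (tripleDim k : ℚ) := by
  have h : PowerSeries.constantCoeff (1 - PowerSeries.X ^ 2 : PowerSeries ℚ) ≠ 0 := by simp
  have h1 : seriesO * seriesS =
      PowerSeries.X ^ 3 * seriesS * (1 - PowerSeries.X ^ 2 : PowerSeries ℚ)⁻¹ := by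
    rw [seriesO]; ring
  rw [h1, eq_comm, PowerSeries.eq_mul_inv_iff_mul_eq h, seriesS_eq, mul_comm, sub_mul, one_mul]
  ext k
  simp only [map_sub, PowerSeries.coeff_X_pow_mul', PowerSeries.coeff_mk]
  have key : tripleDim k =
      (if 2 ≤ k then tripleDim (k - 2) else 0) + if 3 ≤ k then cuspDim (k - 3) else 0 := by
    rcases Nat.even_or_odd' k with ⟨m, rfl | rfl⟩
    · have e1 : tripleDim (2 * m) = 0 := if_pos (even_two_mul m)
      have e2 : tripleDim (2 * m - 2) = 0 := if_pos (by rw [Nat.even_iff]; omega)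
      have e3 : 3 ≤ 2 * m → cuspDim (2 * m - 3) = 0 := fun h =>
        if_neg (by rw [Nat.even_iff]; omega)
      rw [e1, e2]
      split_ifs with h2 h3 h3 <;> simp [*]
    · have e1 : ∀ j, tripleDim (2 * j + 1) =
          ∑ n ∈ Finset.range (j - 1), ((n - 1) / 2 - n / 3) := fun j => by
        rw [tripleDim, if_neg (by rw [Nat.even_iff]; omega)]
        congr 2
        omega
      -- For m = 0 and m = 1 the truncated range is empty. Afterwards it gains one index per step,
      -- whose summand is `cuspDim` at 2m + 2.
      rcases m with _ | _ | m
      · decide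
      · decide
      · have e2 : 2 * (m + 1 + 1) + 1 - 2 = 2 * (m + 1) + 1 := by omega
        rw [e2, e1, e1, if_pos (by omega), if_pos (by omega), cuspDim,
          if_pos (by rw [Nat.even_iff]; omega), show m + 1 + 1 - 1 = m + 1 by omega,
          show m + 1 - 1 = m by omega,
          Finset.sum_range_succ]
        congr 2
        · omega
        · omega
  rw [key]
  push_cast
  ring

end

end OddMZV

theorem mainTheorem1 (N : ℕ)
    (hinj : Function.Injective (OddMZV.tasakaMap N 3 (by norm_num))) :
    PowerSeries.coeff N (2 * OddMZV.seriesO * OddMZV.seriesS) ≤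
      (Module.finrank ℚ (LinearMap.ker (OddMZV.C N 3).mulVecLin) : ℚ) := by
  have h2 : (2 : PowerSeries ℚ) = PowerSeries.C 2 := (map_ofNat _ 2).symm
  rw [mul_assoc, OddMZV.seriesO_mul_seriesS, h2, PowerSeries.coeff_C_mul, PowerSeries.coeff_mk]
  refine le_trans ?_ (Nat.cast_le.2 (OddMZV.two_mul_finrank_W_le hinj))
  rw [Nat.cast_mul, Nat.cast_ofNat]
  refine mul_le_mul_of_nonneg_left (Nat.cast_le.2 ?_) (by norm_num)
  rcases Nat.even_or_odd' N with ⟨M, rfl | rfl⟩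
  · rw [OddMZV.tripleDim, if_pos (even_two_mul M)]
    exact Nat.zero_le _
  · rw [OddMZV.tripleDim, if_neg (by rw [Nat.even_iff]; omega),
      show (2 * M + 1) / 2 = M by omega]
    exact OddMZV.sum_le_finrank_W M _
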